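/- Let $f(x)=\tfrac12 x^\top Qx+q^\top x$ on $\mathbb R^n$ be a strongly convex quadratic function ($Q\in\mathbb R^{n\times n}$ symmetric positive definite, $q\in\mathbb R^n$), with $\mu_f=\lambda_{\min}(Q)>0$ and $L_f=\lambda_{\max}(Q)$. Let $g:\mathbb R^n\to(-\infty,+\infty]$ be a proper closed convex function, $F=f+g$ and $F_\star=\inf F$. For $\gamma>0$ and a convex function $h$ write $\operatorname{prox}_{\gamma h}(x)=\operatorname{argmin}_z\{h(z)+\tfrac1{2\gamma}\|z-x\|^2\}$. Let $0<\gamma<1/L_f$ and put $$D=\gamma\bigl(2(I+\gamma Q)^{-1}-I\bigr)^{-1},\qquad L_h=\frac{1+\gamma L_f}{1-\gamma L_f},$$ $$\mu_h=\lambda_{\min}(D)\,\min\left\{\frac{(1-\gamma\mu_f)\mu_f}{(1+\gamma\mu_f)^2},\frac{(1-\gamma L_f)L_f}{(1+\gamma L_f)^2}\right\}.$$ Given $u^0=x^0\in\mathbb R^n$, let the iterates of the fast Douglas–Rachford splitting be defined for $k\ge 0$ by $$y^k=\operatorname{prox}_{\gamma f}(u^k),\quad z^k=\operatorname{prox}_{\gamma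 g}(2y^k-u^k),\quad x^{k+1}=u^k+\lambda_k(z^k-y^k),\quad u^{k+1}=x^{k+1}+\beta_k(x^{k+1}-x^k),$$ with the constant parameters $$\lambda_k=\frac{1-\gamma L_f}{1+\gamma L_f},\qquad \beta_k=\frac{1-\sqrt{\mu_h/L_h}}{1+\sqrt{\mu_h/L_h}}.$$ Let $\tilde x$ be a solution of $\operatorname{prox}_{\gamma g}(2\operatorname{prox}_{\gamma f}(x)-x)=\operatorname{prox}_{\gamma f}(x)$ (so that $x_\star=\operatorname{prox}_{\gamma f}(\tilde x)$ is the minimizer of $F$). Then for every $k\ge 0$, $$F(z^k)-F_\star\le\frac{L_h}{\lambda_{\min}(D)}\left(1-\sqrt{\frac{\mu_h}{L_h}}\right)^k\|x^0-\tilde x\|^2 .$$ -/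

import Mathlib

namespace FastDRS

noncomputable section

/-- Euclidean space `ℝⁿ`. -/
abbrev E (n : ℕ) : Type := EuclideanSpace ℝ (Fin n)

/-- Proper, closed (lower semicontinuous), convex extended-real-valued functions on `ℝⁿ`. -/
structure IsProperClosedConvex {n : ℕ} (g : E n → EReal) : Prop where
  ne_bot : ∀ x, g x ≠ ⊥
  exists_ne_top : ∃ x, g x ≠ ⊤
  closed : LowerSemicontinuous g
  convex_epigraph : Convex ℝ {p : E n × ℝ | g p.1 ≤ (p.2 : EReal)}

/-- `z = prox_{γ h}(x)`: the point `z` minimizes `w ↦ h(w) + ‖w - x‖² / (2γ)`. -/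
def IsProx {n : ℕ} (γ : ℝ) (h : E n → EReal) (x z : E n) : Prop :=
  IsMinOn (fun w : E n => h w + ((1 / (2 * γ) * ‖w - x‖ ^ 2 : ℝ) : EReal)) Set.univ z

/-- The quadratic function `f(x) = (1/2) x'Qx + q'x`. -/
def quad {n : ℕ} (Q : Matrix (Fin n) (Fin n) ℝ) (q : E n) (x : E n) : ℝ :=
  1 / 2 * (x.ofLp ⬝ᵥ Q.mulVec x.ofLp) + q.ofLp ⬝ᵥ x.ofLp

/-- The quadratic function seen as an extended-real-valued function. -/
def quadE {n : ℕ} (Q : Matrix (Fin n) (Fin n) ℝ) (q : E n) (x : E n) : EReal :=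
  ((quad Q q x : ℝ) : EReal)

/-- The objective `F = f + g`. -/
def objective {n : ℕ} (f g : E n → EReal) (x : E n) : EReal := f x + g x

/-- The optimal value `F_⋆ = inf F`. -/
def optValue {n : ℕ} (f g : E n → EReal) : EReal := ⨅ x, objective f g x

/-- The set of solutions `x` of
`prox_{γ g}(2 prox_{γ f}(x) - x) - prox_{γ f}(x) = 0`. -/
def fixedPoints {n : ℕ} (γ : ℝ) (f g : E n → EReal) : Set (E n) :=
  {x | ∃ p, IsProx γ f x p ∧ IsProx γ g ((2 : ℝ) • p - x) p}

/-- The smallest eigenvalue of a symmetric real matrix. -/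
def lambdaMin {n : ℕ} (A : Matrix (Fin n) (Fin n) ℝ) : ℝ := sInf (spectrum ℝ A)

/-- The largest eigenvalue of a symmetric real matrix. -/
def lambdaMax {n : ℕ} (A : Matrix (Fin n) (Fin n) ℝ) : ℝ := sSup (spectrum ℝ A)

/-- The scaling matrix `D = γ (2 (I + γ Q)⁻¹ - I)⁻¹`. -/
def scalingMatrix {n : ℕ} (Q : Matrix (Fin n) (Fin n) ℝ) (γ : ℝ) : Matrix (Fin n) (Fin n) ℝ :=
  γ • ((2 : ℝ) • (1 + γ • Q)⁻¹ - 1)⁻¹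

/-- The convexity modulus of the Douglas-Rachford envelope of `f + g`, where `f` is the quadratic
function with matrix `Q`, `μ_f = λ_min(Q)` and `L_f = λ_max(Q)`. -/
def muEnvelope {n : ℕ} (Q : Matrix (Fin n) (Fin n) ℝ) (γ : ℝ) : ℝ :=
  min ((1 - γ * lambdaMin Q) * lambdaMin Q / (1 + γ * lambdaMin Q) ^ 2)
    ((1 - γ * lambdaMax Q) * lambdaMax Q / (1 + γ * lambdaMax Q) ^ 2)

/-- The constant `μ_h = λ_min(D) μ_{F^DR}`. -/
def muH {n : ℕ} (Q : Matrix (Fin n) (Fin n) ℝ) (γ : ℝ) : ℝ :=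
  lambdaMin (scalingMatrix Q γ) * muEnvelope Q γ

/-- The constant `L_h = (1 + γ L_f) / (1 - γ L_f)`. -/
def LH {n : ℕ} (Q : Matrix (Fin n) (Fin n) ℝ) (γ : ℝ) : ℝ :=
  (1 + γ * lambdaMax Q) / (1 - γ * lambdaMax Q)

/-- The fast Douglas-Rachford splitting scheme with step sizes `lam k` and extrapolation
parameters `β k`. -/
structure IsFastDRS {n : ℕ} (γ : ℝ) (f g : E n → EReal) (lam β : ℕ → ℝ)
    (x u y z : ℕ → E n) : Prop where
  init : u 0 = x 0
  prox_f : ∀ k, IsProx γ f (u k) (y k)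
  prox_g : ∀ k, IsProx γ g ((2 : ℝ) • y k - u k) (z k)
  step_x : ∀ k, x (k + 1) = u k + lam k • (z k - y k)
  step_u : ∀ k, u (k + 1) = x (k + 1) + β k • (x (k + 1) - x k)

end

end FastDRS

/-!
The fast Douglas–Rachford splitting is Nesterov's method, with constant momentum and step length
`1 / L_h`, applied to the Douglas–Rachford envelope of `f + g` in the metric of `D⁻¹`.

All computations take place in the variable `y = prox_{γ f}(u)`, that is `u = y + γ (Qy + q)`. There
the metric becomes `γ⁻¹ ⟨(I + γQ)a, (I - γQ)b⟩` (`drForm`), and the envelope is the minimum over `w`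
of the model `f(y) + ⟨∇f(y), w - y⟩ + g(w) + ‖w - y‖² / (2γ)` (`drModel`). In this
metric the gradient of the envelope is `ρ = (I + γQ)⁻¹ (y - z)`. Only an exact expansion of the model is needed
(`drModel_expand`): together with the subgradient inequality of `g` at `z` (`IsProx.subgradient`) it
gives strong convexity with modulus `m = μ_h` (`mul_drForm_le`) and smoothness with constant `1`
(`inner_le_drForm`). The envelope at the main iterates is never used: the model at `x^{k+1}` with
`w = z^k` replaces it, so no existence of further proximal points is required.

The point `z^k` comes from the extrapolated point `u^k`, not from `x^k`. This costs nothing, because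
the objective at `z^k` lies below the envelope at `u^k` by at least `½ ‖ρ‖²` in the metric
(`objective_eq_drModel`, `drForm_le_inner`), and the difference between the envelope at `u^k` and
`½ L_h⁻¹ ‖ρ‖²` is what Nesterov's potential controls (`nesterov_step`, `potential_bound`). The initial potential is at
most `½ (1 + m)` times the squared distance to the minimizer in the metric, hence at most
`L_h / λ_min(D) · ‖x⁰ - x̃‖²` (`drForm_le_norm_sq`, `lambdaMin_scalingMatrix`).

The bounds relating the forms reduce, in an eigenbasis of `Q`, to scalar inequalities in
`γλ ∈ (0, 1)`.
-/

open scoped RealInnerProductSpace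

namespace FastDRS

/-! ### The smallest eigenvalue of the scaling matrix -/

section Spectrum

variable {n : ℕ} {Q : Matrix (Fin n) (Fin n) ℝ} {γ : ℝ}

lemma isLeast_lambdaMin (hne : (spectrum ℝ Q).Nonempty) :
    IsLeast (spectrum ℝ Q) (lambdaMin Q) :=
  ⟨hne.csInf_mem Q.finite_real_spectrum, fun _ h => csInf_le Q.finite_real_spectrum.bddBelow h⟩

lemma isGreatest_lambdaMax (hne : (spectrum ℝ Q).Nonempty) :
    IsGreatest (spectrum ℝ Q) (lambdaMax Q) :=
  ⟨hne.csSup_mem Q.finite_real_spectrum, fun _ h => le_csSup Q.finite_real_spectrum.bddAbove h⟩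

/-- The scaling matrix is `γ (1 + γt) / (1 - γt)` applied to `Q` by functional calculus. -/
lemma scalingMatrix_eq_cfc (hQ : Q.IsHermitian)
    (h1 : ∀ t ∈ spectrum ℝ Q, 1 + γ * t ≠ 0) (h2 : ∀ t ∈ spectrum ℝ Q, 1 - γ * t ≠ 0) :
    scalingMatrix Q γ = cfc (fun t : ℝ => γ * ((1 + γ * t) / (1 - γ * t))) Q := by
  have hsa : IsSelfAdjoint Q := hQ
  have hc : ∀ f : ℝ → ℝ, ContinuousOn f (spectrum ℝ Q) := fun f =>
    Q.finite_real_spectrum.continuousOn f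
  have e1 : 1 + γ • Q = cfc (fun t : ℝ => 1 + γ * t) Q := by
    rw [cfc_const_add (1 : ℝ) (fun t => γ * t) Q (hc _) hsa, cfc_const_mul_id γ Q hsa, map_one]
  have i1 : (1 + γ • Q)⁻¹ = cfc (fun t : ℝ => (1 + γ * t)⁻¹) Q := by
    apply Matrix.inv_eq_right_inv
    rw [e1, ← cfc_mul _ _ Q (hc _) (hc _), ← cfc_const_one ℝ Q hsa]
    exact cfc_congr fun t ht => mul_inv_cancel₀ (h1 t ht)
  have e2 : (2 : ℝ) • (1 + γ • Q)⁻¹ - 1 = cfc (fun t : ℝ => 2 * (1 + γ * t)⁻¹ - 1) Q := by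
    rw [cfc_sub _ _ Q (hc _) (hc _), cfc_const_mul _ _ Q (hc _), cfc_const_one ℝ Q hsa, i1]
  have i2 : ((2 : ℝ) • (1 + γ • Q)⁻¹ - 1)⁻¹ =
      cfc (fun t : ℝ => (1 + γ * t) / (1 - γ * t)) Q := by
    apply Matrix.inv_eq_right_inv
    rw [e2, ← cfc_mul _ _ Q (hc _) (hc _), ← cfc_const_one ℝ Q hsa]
    refine cfc_congr fun t ht => ?_
    have := h1 t ht
    have := h2 t ht
    field_simp
    ring
  rw [scalingMatrix, i2, cfc_const_mul _ _ Q (hc _)]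

lemma lambdaMin_scalingMatrix (hQ : Q.IsHermitian) (hne : (spectrum ℝ Q).Nonempty) (hγ : 0 < γ)
    (hpos : 0 < lambdaMin Q) (hlt : γ * lambdaMax Q < 1) :
    lambdaMin (scalingMatrix Q γ) =
      γ * ((1 + γ * lambdaMin Q) / (1 - γ * lambdaMin Q)) := by
  have hsa : IsSelfAdjoint Q := hQ
  have hmin := isLeast_lambdaMin hne
  have hbound : ∀ t ∈ spectrum ℝ Q, 0 < γ * t ∧ γ * t < 1 := fun t ht =>
    ⟨mul_pos hγ (hpos.trans_le (hmin.2 ht)),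
      (mul_le_mul_of_nonneg_left ((isGreatest_lambdaMax hne).2 ht) hγ.le).trans_lt hlt⟩
  rw [lambdaMin, scalingMatrix_eq_cfc hQ (fun t ht => by linarith [hbound t ht])
    (fun t ht => by linarith [hbound t ht]),
    cfc_map_spectrum _ Q hsa (Q.finite_real_spectrum.continuousOn _)]
  refine IsLeast.csInf_eq ⟨⟨_, hmin.1, rfl⟩, ?_⟩
  rintro _ ⟨t, ht, rfl⟩
  have h0 := hbound _ hmin.1
  have h1 := hbound _ ht
  have h2 := mul_le_mul_of_nonneg_left (hmin.2 ht) hγ.le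
  dsimp only
  refine mul_le_mul_of_nonneg_left ?_ hγ.le
  exact div_le_div₀ (by linarith) (by linarith) (by linarith) (by linarith)

end Spectrum

/-! ### Subgradient inequality for proximal points -/

section Prox

variable {n : ℕ}

/-- The first-order term of a quadratic that is nonnegative on `(0, 1)` is nonnegative. -/
lemma nonneg_of_forall_mul_add_sq {a b : ℝ}
    (h : ∀ t : ℝ, 0 < t → t < 1 → 0 ≤ t * a + t ^ 2 * b) : 0 ≤ a := by
  have h1 : ∀ᶠ t : ℝ in nhdsWithin 0 (Set.Ioi 0), 0 ≤ a + t * b := by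
    filter_upwards [Ioo_mem_nhdsGT (zero_lt_one' ℝ)] with t ht
    refine nonneg_of_mul_nonneg_right (a := t) ?_ ht.1
    linarith [h t ht.1 ht.2, show t * (a + t * b) = t * a + t ^ 2 * b by ring]
  have h2 : Filter.Tendsto (fun t : ℝ => a + t * b) (nhdsWithin 0 (Set.Ioi 0)) (nhds a) := by
    have : Continuous fun t : ℝ => a + t * b := by fun_prop
    simpa using (this.tendsto 0).mono_left nhdsWithin_le_nhds
  exact ge_of_tendsto h2 h1

/-- A proximal point of a proper convex function lies in its domain. -/
lemma IsProx.ne_top {γ : ℝ} {g : E n → EReal} (hg : IsProperClosedConvex g) {x z : E n}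
    (hz : IsProx γ g x z) : g z ≠ ⊤ := by
  obtain ⟨w, hw⟩ := hg.exists_ne_top
  intro htop
  have h := isMinOn_iff.1 hz w (Set.mem_univ _)
  rw [htop, EReal.top_add_coe, top_le_iff] at h
  exact EReal.add_ne_top hw (EReal.coe_ne_top _) h

lemma IsProperClosedConvex.coe_toReal {g : E n → EReal} (hg : IsProperClosedConvex g) {x : E n}
    (hx : g x ≠ ⊤) : ((g x).toReal : EReal) = g x :=
  EReal.coe_toReal hx (hg.ne_bot x)

/-- Optimality of a proximal point: `γ⁻¹ (x - z)` is a subgradient at `z = prox_{γ g}(x)`. -/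
lemma IsProx.subgradient {γ : ℝ} {g : E n → EReal} (hg : IsProperClosedConvex g)
    {x z : E n} (hz : IsProx γ g x z) {w : E n} (hw : g w ≠ ⊤) :
    (g z).toReal + ⟪γ⁻¹ • (x - z), w - z⟫ ≤ (g w).toReal := by
  have ez := hg.coe_toReal (hz.ne_top hg)
  have ew := hg.coe_toReal hw
  suffices 0 ≤ (g w).toReal - (g z).toReal - ⟪γ⁻¹ • (x - z), w - z⟫ by linarith
  refine nonneg_of_forall_mul_add_sq (b := 1 / (2 * γ) * ‖w - z‖ ^ 2) fun t h0 h1 => ?_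
  have hconv := hg.convex_epigraph (x := (z, (g z).toReal)) (y := (w, (g w).toReal))
    (by simp [ez]) (by simp [ew]) (sub_nonneg.2 h1.le) h0.le (by ring)
  simp only [Prod.smul_mk, Prod.mk_add_mk, Set.mem_ofPred_eq, smul_eq_mul] at hconv
  have hmin := isMinOn_iff.1 hz ((1 - t) • z + t • w) (Set.mem_univ _)
  have h2 := hmin.trans (add_le_add_left hconv _)
  rw [← ez] at h2
  norm_cast at h2
  have h3 : (1 - t) • z + t • w - x = (z - x) + t • (w - z) := by module
  rw [h3, norm_add_sq_real, norm_smul, inner_smul_right, mul_pow, Real.norm_eq_abs, sq_abs] at h2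
  have h4 : ⟪γ⁻¹ • (x - z), w - z⟫ = -(γ⁻¹ * ⟪z - x, w - z⟫) := by
    rw [← neg_sub z x, smul_neg, inner_neg_left, real_inner_smul_left]
  rw [h4]
  have h5 : 1 / (2 * γ) * (2 * (t * ⟪z - x, w - z⟫)) = t * (γ⁻¹ * ⟪z - x, w - z⟫) := by
    rcases eq_or_ne γ 0 with rfl | hγ
    · simp
    · field_simp
  rw [mul_add, mul_add, h5, EReal.toReal_coe] at h2
  linarith

end Prox

/-! ### The linearized model behind the Douglas–Rachford envelope -/

section Quadratic

variable {V : Type*} [NormedAddCommGroup V] [InnerProductSpace ℝ V]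

/-- The form `⟨a, b⟩_* = γ⁻¹ ⟨(I + γT)a, (I - γT)b⟩`. With `D⁻¹ = γ⁻¹ (I - γT)(I + γT)⁻¹` this is
the inner product `⟨·, D⁻¹ ·⟩` of the `u`-variable, pulled back along `y ↦ (I + γT)y`. Working with
`y` instead of `u` leaves a polynomial in `T`, so that no inverse or square root of `D` is needed. -/
noncomputable def drForm (γ : ℝ) (T : V →ₗ[ℝ] V) : V →ₗ[ℝ] V →ₗ[ℝ] ℝ :=
  γ⁻¹ • (innerₗ V).compl₁₂ (LinearMap.id + γ • T) (LinearMap.id - γ • T)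

lemma drForm_apply (γ : ℝ) (T : V →ₗ[ℝ] V) (a b : V) :
    drForm γ T a b = γ⁻¹ * ⟪a + γ • T a, b - γ • T b⟫ := by
  rfl

lemma drForm_comm {T : V →ₗ[ℝ] V} (hT : T.IsSymmetric) (γ : ℝ) (a b : V) :
    drForm γ T a b = drForm γ T b a := by
  simp only [drForm_apply, inner_add_left, inner_sub_right, real_inner_smul_left,
    real_inner_smul_right]
  have h1 : ⟪a, T b⟫ = ⟪b, T a⟫ := by rw [real_inner_comm, hT]
  have h2 : ⟪T a, b⟫ = ⟪T b, a⟫ := by rw [hT, h1, hT]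
  rw [h1, h2, real_inner_comm (T b) (T a), real_inner_comm a b]

/-- The quadratic function `½ ⟨x, Tx⟩ + ⟨q, x⟩`. -/
noncomputable def quadFun (T : V →ₗ[ℝ] V) (q x : V) : ℝ := 1 / 2 * ⟪x, T x⟫ + ⟪q, x⟫

lemma quadFun_add {T : V →ₗ[ℝ] V} (hT : T.IsSymmetric) (q x d : V) :
    quadFun T q (x + d) = quadFun T q x + ⟪T x + q, d⟫ + 1 / 2 * ⟪d, T d⟫ := by
  have h1 : ⟪x, T d⟫ = ⟪T x, d⟫ := (hT x d).symm
  have h2 : ⟪d, T x⟫ = ⟪T x, d⟫ := real_inner_comm _ _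
  simp only [quadFun, map_add, inner_add_left, inner_add_right, h1, h2]
  ring

/-- The proximal-gradient model of the objective at `y`, evaluated at `w`. The real number `c` stands
for `g w`; with `y = prox_{γ f}(u)` and `c = g w`, the minimum over `w` is the Douglas–Rachford
envelope at `u`. -/
noncomputable def drModel (γ : ℝ) (T : V →ₗ[ℝ] V) (q y w : V) (c : ℝ) : ℝ :=
  quadFun T q y + ⟪T y + q, w - y⟫ + c + 1 / (2 * γ) * ‖w - y‖ ^ 2

/-- Exact expansion of the model around `(y, z)`. Here `ρ` is the gradient of the envelope in the
metric `drForm`, and the bracket is the error in the subgradient inequality of `g` at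
`z = prox_{γ g}(2y - u)`, where `u = y + γ ∇f(y)`. -/
lemma drModel_expand {T : V →ₗ[ℝ] V} (hT : T.IsSymmetric) {γ : ℝ} (hγ : γ ≠ 0) (q : V)
    {y z ρ : V} (hρ : ρ + γ • T ρ = y - z) (d w : V) (c c' : ℝ) :
    drModel γ T q (y + d) w c' = drModel γ T q y z c +
      (c' - c - ⟪γ⁻¹ • (y - z) - (T y + q), w - z⟫) + drForm γ T ρ d
      + 1 / 2 * ⟪T d, d - γ • T d⟫ + 1 / (2 * γ) * ‖w - z - d + γ • T d‖ ^ 2 := by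
  obtain ⟨e, rfl⟩ : ∃ e, w = z + e := ⟨w - z, by abel⟩
  obtain ⟨r, rfl⟩ : ∃ r, z = y - r := ⟨y - z, by abel⟩
  rw [drForm_apply, hρ, drModel, drModel, quadFun_add hT]
  have e1 : y - r + e - (y + d) = e - d - r := by abel
  have e2 : y - r - y = -r := by abel
  have e3 : y - (y - r) = r := by abel
  have e4 : y - r + e - (y - r) = e := by abel
  rw [e1, e2, e3, e4]
  generalize hG : T y + q = G
  have hG' : T (y + d) + q = G + T d := by rw [← hG, map_add]; abel
  rw [hG']
  generalize T d = D
  simp only [← real_inner_self_eq_norm_sq, inner_add_left, inner_add_right, inner_sub_left,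
    inner_sub_right, real_inner_smul_left, real_inner_smul_right, inner_neg_left, inner_neg_right]
  rw [real_inner_comm d D, real_inner_comm d e, real_inner_comm r e, real_inner_comm r d,
    real_inner_comm r D, real_inner_comm D e]
  field_simp
  ring

/-- When only the base point moves and `z` is kept, the model is an exact quadratic. -/
lemma drModel_add {T : V →ₗ[ℝ] V} (hT : T.IsSymmetric) {γ : ℝ} (hγ : γ ≠ 0) (q : V)
    {y z ρ : V} (hρ : ρ + γ • T ρ = y - z) (d : V) (c : ℝ) :
    drModel γ T q (y + d) z c = drModel γ T q y z c + drForm γ T ρ d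
      + 1 / 2 * (γ⁻¹ * ⟪d, d - γ • T d⟫) := by
  have e1 : z - z - d + γ • T d = -(d - γ • T d) := by abel
  have e2 : ‖d - γ • T d‖ ^ 2 = ⟪d, d - γ • T d⟫ - γ * ⟪T d, d - γ • T d⟫ := by
    rw [← real_inner_self_eq_norm_sq, inner_sub_left, real_inner_smul_left]
  rw [drModel_expand hT hγ q hρ d z c c, e1, norm_neg, e2, sub_self z, inner_zero_right]
  field_simp
  ring

/-- The objective at `z` lies below the model value by a quadratic in the residual `y - z`. -/
lemma objective_eq_drModel {T : V →ₗ[ℝ] V} (hT : T.IsSymmetric) {γ : ℝ} (hγ : γ ≠ 0)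
    (q y z : V) (c : ℝ) :
    quadFun T q z + c = drModel γ T q y z c
      - 1 / 2 * (γ⁻¹ * ⟪y - z, (y - z) - γ • T (y - z)⟫) := by
  obtain ⟨r, rfl⟩ : ∃ r, z = y - r := ⟨y - z, by abel⟩
  have e2 : y - r - y = -r := by abel
  have e3 : y - (y - r) = r := by abel
  rw [drModel, e2, e3, sub_eq_add_neg y r, quadFun_add hT, map_neg, inner_neg_neg, norm_neg,
    inner_sub_right, real_inner_smul_right, real_inner_self_eq_norm_sq]
  field_simp
  ring

end Quadratic

/-! ### One step of Nesterov's potential argument -/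

section Nesterov

variable {V : Type*} [AddCommGroup V] [Module ℝ V]

/-- One step of Nesterov's constant-momentum scheme with step length `s` and modulus `m`, where
`θ² = m s`. The hypothesis `hG` is the linearization bound at the previous main iterate `a`, `hF` the
strong convexity bound at the minimizer `xs`, and `v` is the auxiliary sequence determined by
`(1 + θ) y = a + θ v`. The quantity bounded is `ψ - (s/2) ⟨ρ, ρ⟩`, the value guaranteed after a
gradient step from `y`, rather than the value at the next iterate. -/
lemma nesterov_step {B : V →ₗ[ℝ] V →ₗ[ℝ] ℝ} (hB : ∀ a b, B a b = B b a)
    (hB0 : ∀ a, 0 ≤ B a a) {m s θ : ℝ} (hm : 0 < m) (hθ : θ ^ 2 = m * s) (hθ0 : 0 < θ)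
    (hθ1 : θ ≤ 1) {a v y ρ xs : V} (hy : (1 + θ) • y = a + θ • v) {ψ G Fs : ℝ}
    (hG : ψ + B ρ (a - y) ≤ G)
    (hF : ψ + B ρ (xs - y) + m / 2 * B (xs - y) (xs - y) ≤ Fs) :
    ψ - s / 2 * B ρ ρ - Fs
        + m / 2 * B (((1 - θ) • v + θ • y - (θ / m) • ρ) - xs)
          (((1 - θ) • v + θ • y - (θ / m) • ρ) - xs)
      ≤ (1 - θ) * (G - Fs + m / 2 * B (v - xs) (v - xs)) := by
  obtain ⟨ν, rfl⟩ : ∃ ν, v = xs + ν := ⟨v - xs, by abel⟩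
  obtain ⟨η, rfl⟩ : ∃ η, y = xs + η := ⟨y - xs, by abel⟩
  have ha : a = xs + (1 + θ) • η - θ • ν := by
    rw [eq_sub_of_add_eq hy.symm]; module
  subst ha
  have e1 : xs + (1 + θ) • η - θ • ν - (xs + η) = θ • (η - ν) := by module
  have e2 : xs - (xs + η) = -η := by abel
  have e3 : (1 - θ) • (xs + ν) + θ • (xs + η) - (θ / m) • ρ - xs
      = ν + θ • (η - ν) - (θ / m) • ρ := by module
  have e4 : xs + ν - xs = ν := by abel
  rw [e1] at hG
  rw [e2] at hF
  rw [e3, e4]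
  have hs : s = θ ^ 2 / m := by rw [hθ]; field_simp
  have key := hB0 (η - ν)
  simp only [map_add, map_sub, map_neg, map_smul, LinearMap.add_apply, LinearMap.sub_apply,
    LinearMap.neg_apply, LinearMap.smul_apply, smul_eq_mul] at hG hF key ⊢
  rw [hB ν ρ, hB η ρ] at *
  rw [hB ν η] at *
  have h1 := mul_le_mul_of_nonneg_left hG (sub_nonneg.2 hθ1)
  have h2 := mul_le_mul_of_nonneg_left hF hθ0.le
  have h3 := mul_nonneg (mul_nonneg (mul_nonneg hm.le hθ0.le) (sub_nonneg.2 hθ1)) key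
  rw [hs]
  have h4 : m * (θ / m) = θ := by field_simp
  have h5 : θ ^ 2 / m = m * (θ / m) ^ 2 := by field_simp
  rw [h5]
  generalize θ / m = τ at *
  subst h4
  linear_combination h1 + h2 + 1 / 2 * h3

end Nesterov

/-! ### Bounds for the metric in an eigenbasis -/

section Eigenbasis

variable {V : Type*} [NormedAddCommGroup V] [InnerProductSpace ℝ V] {ι : Type*} [Fintype ι]
  {b : OrthonormalBasis ι ℝ V} {l : ι → ℝ} {T : V →ₗ[ℝ] V}

lemma inner_eigenbasis_map (hT : ∀ i, T (b i) = l i • b i) (i : ι) (x : V) :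
    ⟪b i, T x⟫ = l i * ⟪b i, x⟫ := by
  classical
  conv_lhs => rw [← b.sum_repr' x]
  rw [map_sum, inner_sum, Finset.sum_eq_single i]
  · rw [map_smul, hT, inner_smul_right, inner_smul_right, real_inner_self_eq_norm_sq,
      b.orthonormal.1 i]
    ring
  · intro j _ hj
    rw [map_smul, hT, inner_smul_right, inner_smul_right, b.orthonormal.2 hj.symm]
    ring
  · simp

lemma inner_eq_sum_eigenbasis (b : OrthonormalBasis ι ℝ V) (x y : V) :
    ⟪x, y⟫ = ∑ i, ⟪b i, x⟫ * ⟪b i, y⟫ := by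
  simp_rw [← b.sum_inner_mul_inner x y, real_inner_comm (b _) x]

lemma isSymmetric_of_eigenbasis (hT : ∀ i, T (b i) = l i • b i) : T.IsSymmetric := fun x y => by
  rw [inner_eq_sum_eigenbasis b, inner_eq_sum_eigenbasis b]
  simp_rw [inner_eigenbasis_map hT]
  exact Finset.sum_congr rfl fun i _ => by ring

variable {γ μ : ℝ}

/-- `I + γT` is invertible when the eigenvalues of `γT` are positive. -/
lemma exists_resolvent (hT : ∀ i, T (b i) = l i • b i) (hp : ∀ i, 0 < γ * l i) :
    ∃ A : V →ₗ[ℝ] V, (∀ v, A v + γ • T (A v) = v) ∧ ∀ v, A (v + γ • T v) = v := by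
  have hfd : FiniteDimensional ℝ V := b.toBasis.finiteDimensional_of_finite
  have hinj : Function.Injective (LinearMap.id + γ • T : V →ₗ[ℝ] V) := by
    rw [← LinearMap.ker_eq_bot, LinearMap.ker_eq_bot']
    intro v hv
    refine b.toBasis.ext_elem fun i => ?_
    have h : ⟪b i, v + γ • T v⟫ = 0 := by
      rw [show v + γ • T v = 0 from hv, inner_zero_right]
    rw [inner_add_right, inner_smul_right, inner_eigenbasis_map hT] at h
    have h' : (1 + γ * l i) * ⟪b i, v⟫ = 0 := by linarith
    have := (mul_eq_zero.1 h').resolve_left (by linarith [hp i])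
    simpa [b.repr_apply_apply] using this
  let e := LinearEquiv.ofInjectiveEndo _ hinj
  exact ⟨e.symm, fun v => e.apply_symm_apply v, fun v => e.symm_apply_apply v⟩

lemma drForm_eq_sum (hT : ∀ i, T (b i) = l i • b i) (x y : V) :
    drForm γ T x y =
      ∑ i, γ⁻¹ * ((1 + γ * l i) * (1 - γ * l i)) * (⟪b i, x⟫ * ⟪b i, y⟫) := by
  rw [drForm_apply, inner_eq_sum_eigenbasis b, Finset.mul_sum]
  refine Finset.sum_congr rfl fun i _ => ?_
  rw [inner_add_right, inner_sub_right, inner_smul_right, inner_smul_right,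
    inner_eigenbasis_map hT, inner_eigenbasis_map hT]
  ring

lemma drForm_self_nonneg (hT : ∀ i, T (b i) = l i • b i) (hγ : 0 < γ) (hp : ∀ i, 0 < γ * l i)
    (hp1 : ∀ i, γ * l i < 1) (d : V) : 0 ≤ drForm γ T d d := by
  rw [drForm_eq_sum hT]
  exact Finset.sum_nonneg fun i _ => mul_nonneg (mul_nonneg (inv_nonneg.2 hγ.le)
    (mul_nonneg (by linarith [hp i]) (by linarith [hp1 i]))) (mul_self_nonneg _)

/-- Strong convexity modulus `m` of the envelope in the metric `drForm`. -/
lemma mul_drForm_le (hT : ∀ i, T (b i) = l i • b i) (hγ : 0 < γ)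
    (hp1 : ∀ i, γ * l i < 1) {m : ℝ} (hm : ∀ i, m * (1 + γ * l i) ≤ γ * l i) (d : V) :
    m * drForm γ T d d ≤ ⟪T d, d - γ • T d⟫ := by
  rw [drForm_eq_sum hT, inner_eq_sum_eigenbasis b, Finset.mul_sum]
  refine Finset.sum_le_sum fun i _ => ?_
  rw [inner_sub_right, inner_smul_right, inner_eigenbasis_map hT]
  have h := mul_le_mul_of_nonneg_right (hm i)
    (mul_nonneg (mul_nonneg (inv_nonneg.2 hγ.le) (sub_nonneg.2 (hp1 i).le))
      (mul_self_nonneg ⟪b i, d⟫))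
  have e : γ * l i * (γ⁻¹ * (1 - γ * l i) * (⟪b i, d⟫ * ⟪b i, d⟫)) =
      l i * ⟪b i, d⟫ * (⟪b i, d⟫ - γ * (l i * ⟪b i, d⟫)) := by
    field_simp
  rw [← e]
  linarith

/-- Smoothness of the envelope with constant `1` in the metric `drForm`. -/
lemma inner_le_drForm (hT : ∀ i, T (b i) = l i • b i) (hγ : 0 < γ) (hp : ∀ i, 0 < γ * l i)
    (hp1 : ∀ i, γ * l i < 1) (d : V) : γ⁻¹ * ⟪d, d - γ • T d⟫ ≤ drForm γ T d d := by
  rw [drForm_eq_sum hT, inner_eq_sum_eigenbasis b, Finset.mul_sum]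
  refine Finset.sum_le_sum fun i _ => ?_
  rw [inner_sub_right, inner_smul_right, inner_eigenbasis_map hT]
  have h := mul_nonneg (hp i).le
    (mul_nonneg (mul_nonneg (inv_nonneg.2 hγ.le) (sub_nonneg.2 (hp1 i).le))
      (mul_self_nonneg ⟪b i, d⟫))
  linarith

/-- The squared gradient in the metric `drForm` is dominated by the gap, up to the factor `1/2`,
between the model value and the objective at `z`, where `d + γ T d` is the residual `y - z`. -/
lemma drForm_le_inner (hT : ∀ i, T (b i) = l i • b i) (hγ : 0 < γ) (hp : ∀ i, 0 < γ * l i)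
    (hp1 : ∀ i, γ * l i < 1) (d : V) :
    drForm γ T d d ≤ γ⁻¹ * ⟪d + γ • T d, (d + γ • T d) - γ • T (d + γ • T d)⟫ := by
  rw [drForm_eq_sum hT, inner_eq_sum_eigenbasis b, Finset.mul_sum]
  refine Finset.sum_le_sum fun i _ => ?_
  rw [map_add, map_smul, inner_sub_right, inner_smul_right, inner_add_right, inner_add_right,
    inner_smul_right, inner_smul_right, inner_eigenbasis_map hT, inner_eigenbasis_map hT,
    inner_eigenbasis_map hT]
  have h := mul_nonneg (mul_nonneg (hp i).le (by linarith [hp i] : 0 ≤ 1 + γ * l i))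
    (mul_nonneg (mul_nonneg (inv_nonneg.2 hγ.le) (sub_nonneg.2 (hp1 i).le))
      (mul_self_nonneg ⟪b i, d⟫))
  linarith

/-- The metric `drForm` is bounded by `λ_min(D)⁻¹` times the squared norm in the `u`-variable, where
`λ_min(D) = γ (1 + a) / (1 - a)` for `a = γ λ_min`. -/
lemma drForm_le_norm_sq (hT : ∀ i, T (b i) = l i • b i) (hγ : 0 < γ) {a : ℝ} (ha : 0 < a)
    (hp : ∀ i, a ≤ γ * l i) (d : V) :
    drForm γ T d d ≤ (γ * ((1 + a) / (1 - a)))⁻¹ * ‖d + γ • T d‖ ^ 2 := by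
  rw [drForm_eq_sum hT, ← real_inner_self_eq_norm_sq, inner_eq_sum_eigenbasis b, Finset.mul_sum]
  refine Finset.sum_le_sum fun i _ => ?_
  rw [inner_add_right, inner_smul_right, inner_eigenbasis_map hT]
  have h1 := hp i
  have h2 : 1 - γ * l i ≤ (1 - a) / (1 + a) * (1 + γ * l i) := by
    rw [div_mul_eq_mul_div, le_div_iff₀ (by linarith)]
    linarith
  have h := mul_le_mul_of_nonneg_right h2
    (mul_nonneg (mul_nonneg (inv_nonneg.2 hγ.le) (by linarith : 0 ≤ 1 + γ * l i))
      (mul_self_nonneg ⟪b i, d⟫))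
  rw [mul_inv, inv_div]
  linarith

end Eigenbasis

/-! ### Accelerated convergence of the model values -/

section Convergence

variable {V : Type*} [NormedAddCommGroup V] [InnerProductSpace ℝ V] {T : V →ₗ[ℝ] V}
  {q : V} {γ m s θ : ℝ} {a y z ρ : ℕ → V} {c : ℕ → ℝ} {p : V} {cp : ℝ}

/-- Linear convergence of the model values at the extrapolated points, less the guaranteed decrease.
In the `y`-variable, `a k`, `y k`, `ρ k` are the main iterates, the extrapolated points and the
gradients in the metric `drForm`; `c k` and `cp` are the values of `g` at `z k` and at the minimizer
`p`. -/
lemma potential_bound (hT : T.IsSymmetric) (hγ : 0 < γ)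
    (hB0 : ∀ d, 0 ≤ drForm γ T d d)
    (hstrong : ∀ d, m * drForm γ T d d ≤ ⟪T d, d - γ • T d⟫)
    (hsmooth : ∀ d, γ⁻¹ * ⟪d, d - γ • T d⟫ ≤ drForm γ T d d)
    (hm : 0 < m) (hs0 : 0 < s) (hs1 : s ≤ 1) (hθ : θ ^ 2 = m * s) (hθ0 : 0 < θ) (hθ1 : θ ≤ 1)
    (hρ : ∀ k, ρ k + γ • T (ρ k) = y k - z k)
    (hsub : ∀ k j, c k + ⟪γ⁻¹ • (y k - z k) - (T (y k) + q), z j - z k⟫ ≤ c j)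
    (hsubp : ∀ k, c k + ⟪γ⁻¹ • (y k - z k) - (T (y k) + q), p - z k⟫ ≤ cp)
    (h0 : y 0 = a 0) (ha : ∀ k, a (k + 1) = y k - s • ρ k)
    (hy : ∀ k, (1 + θ) • y (k + 1) = (1 + θ) • a (k + 1) + (1 - θ) • (a (k + 1) - a k))
    (k : ℕ) :
    drModel γ T q (y k) (z k) (c k) - s / 2 * drForm γ T (ρ k) (ρ k) - (quadFun T q p + cp)
      ≤ (1 - θ) ^ (k + 1) * ((1 + m) / 2 * drForm γ T (y 0 - p) (y 0 - p)) := by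
  have hBc := drForm_comm hT γ
  -- the value of the model at `(p, p)`
  have hp : drModel γ T q p p cp = quadFun T q p + cp := by simp [drModel]
  -- lower bound of the model at an arbitrary point by the linearization at `y k`
  have low : ∀ k y' w cw, c k + ⟪γ⁻¹ • (y k - z k) - (T (y k) + q), w - z k⟫ ≤ cw →
      drModel γ T q (y k) (z k) (c k) + drForm γ T (ρ k) (y' - y k)
        + m / 2 * drForm γ T (y' - y k) (y' - y k) ≤ drModel γ T q y' w cw := by
    intro k y' w cw hw
    have h := drModel_expand hT hγ.ne' q (hρ k) (y' - y k) w (c k) cw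
    rw [add_sub_cancel] at h
    have h2 := hstrong (y' - y k)
    have h3 : 0 ≤ 1 / (2 * γ) * ‖w - z k - (y' - y k) + γ • T (y' - y k)‖ ^ 2 := by positivity
    linarith
  -- decrease of the model along the step of length `s`
  have up : ∀ k, drModel γ T q (a (k + 1)) (z k) (c k) ≤
      drModel γ T q (y k) (z k) (c k) - s / 2 * drForm γ T (ρ k) (ρ k) := by
    intro k
    have h := drModel_add hT hγ.ne' q (hρ k) (-(s • ρ k)) (c k)
    rw [← sub_eq_add_neg, ← ha] at h
    have h2 := hsmooth (-(s • ρ k))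
    simp only [map_neg, map_smul, LinearMap.neg_apply, LinearMap.smul_apply, smul_eq_mul] at h h2
    have h3 : 0 ≤ s * (1 - s) * drForm γ T (ρ k) (ρ k) :=
      mul_nonneg (mul_nonneg hs0.le (sub_nonneg.2 hs1)) (hB0 _)
    linarith
  -- the auxiliary sequence of the potential; its recursion is `hvs`
  let v : ℕ → V := fun k => θ⁻¹ • ((1 + θ) • y k - a k)
  have hv : ∀ k, (1 + θ) • y k = a k + θ • v k := fun k => by
    simp only [v]; rw [smul_inv_smul₀ hθ0.ne']; abel
  have hθm : θ / m = s / θ := by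
    rw [div_eq_div_iff hm.ne' hθ0.ne', ← sq, hθ, mul_comm]
  have hvs : ∀ k, v (k + 1) = (1 - θ) • v k + θ • y k - (θ / m) • ρ k := fun k => by
    have e : θ • v (k + 1) = θ • ((1 - θ) • v k + θ • y k - (θ / m) • ρ k) := by
      have e1 : θ • v (k + 1) = a (k + 1) - (1 - θ) • a k := by
        rw [eq_sub_of_add_eq' (hv (k + 1)).symm, hy]
        module
      have e2 : θ • (θ / m) • ρ k = s • ρ k := by
        rw [smul_smul, hθm, mul_div_cancel₀ _ hθ0.ne']
      rw [e1, smul_sub, e2, smul_add, smul_comm θ (1 - θ), eq_sub_of_add_eq' (hv k).symm, ha]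
      module
    exact smul_right_injective V hθ0.ne' e
  have hFk : ∀ k, drModel γ T q (y k) (z k) (c k) + drForm γ T (ρ k) (p - y k)
      + m / 2 * drForm γ T (p - y k) (p - y k) ≤ quadFun T q p + cp := fun k => by
    rw [← hp]; exact low k p p cp (hsubp _)
  have main : ∀ k, drModel γ T q (y k) (z k) (c k) - s / 2 * drForm γ T (ρ k) (ρ k)
      - (quadFun T q p + cp) + m / 2 * drForm γ T (v (k + 1) - p) (v (k + 1) - p)
      ≤ (1 - θ) ^ (k + 1) * ((1 + m) / 2 * drForm γ T (y 0 - p) (y 0 - p)) := by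
    intro k
    induction k with
    | zero =>
      have hv0 : v 0 = y 0 := by
        simp only [v, ← h0]
        rw [show (1 + θ) • y 0 - y 0 = θ • y 0 by module, inv_smul_smul₀ hθ0.ne']
      have h := nesterov_step hBc hB0 hm hθ hθ0 hθ1 (hv 0)
        (G := drModel γ T q (y 0) (z 0) (c 0)) (by simp [← h0]) (hFk 0)
      rw [← hvs, hv0] at h
      refine h.trans ?_
      rw [zero_add, pow_one]
      refine mul_le_mul_of_nonneg_left ?_ (sub_nonneg.2 hθ1)
      have h1 := low 0 (y 0) p cp (hsubp _)
      rw [sub_self, map_zero, map_zero] at h1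
      have h2 := drModel_add hT hγ.ne' q (y := p) (z := p) (ρ := 0) (by simp) (y 0 - p) cp
      rw [add_sub_cancel, hp, map_zero, LinearMap.zero_apply] at h2
      linarith [hsmooth (y 0 - p)]
    | succ k ih =>
      have hG := low (k + 1) (a (k + 1)) (z k) (c k) (hsub _ _)
      have h := nesterov_step hBc hB0 hm hθ hθ0 hθ1 (hv (k + 1))
        (G := drModel γ T q (y k) (z k) (c k) - s / 2 * drForm γ T (ρ k) (ρ k))
        (by have := mul_nonneg (half_pos hm).le (hB0 (a (k + 1) - y (k + 1)))
            linarith [up k]) (hFk (k + 1))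
      rw [← hvs] at h
      refine h.trans ?_
      rw [pow_succ' (1 - θ) (k + 1), mul_assoc]
      exact mul_le_mul_of_nonneg_left ih (sub_nonneg.2 hθ1)
  have := mul_nonneg (half_pos hm).le (hB0 (v (k + 1) - p))
  linarith [main k]

end Convergence

/-! ### Translation to the quadratic data on `ℝⁿ` -/

section Euclidean

variable {n : ℕ} {Q : Matrix (Fin n) (Fin n) ℝ} {q : E n} {γ : ℝ}

lemma quad_eq_quadFun (Q : Matrix (Fin n) (Fin n) ℝ) (q x : E n) :
    quad Q q x = quadFun Q.toEuclideanLin q x := by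
  simp only [quad, quadFun, EuclideanSpace.inner_eq_star_dotProduct, star_trivial,
    Matrix.toLpLin_apply]
  rw [dotProduct_comm, dotProduct_comm x.ofLp q.ofLp]

lemma toEuclideanLin_eigenvectorBasis (hQ : Q.IsHermitian) (i : Fin n) :
    Q.toEuclideanLin (hQ.eigenvectorBasis i) = hQ.eigenvalues i • hQ.eigenvectorBasis i := by
  rw [Matrix.toLpLin_apply, hQ.mulVec_eigenvectorBasis]
  rfl

lemma eigenvalues_pos_of_strongConvexOn (hQ : Q.IsHermitian) {m : ℝ} (hm : 0 < m)
    (hf : StrongConvexOn Set.univ m (quad Q q)) (i : Fin n) : 0 < hQ.eigenvalues i := by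
  obtain ⟨-, hc⟩ := hf
  have h := hc (Set.mem_univ (hQ.eigenvectorBasis i)) (Set.mem_univ (-hQ.eigenvectorBasis i))
    one_half_pos.le one_half_pos.le (add_halves (1 : ℝ))
  have e : ‖hQ.eigenvectorBasis i - -hQ.eigenvectorBasis i‖ = 2 := by
    rw [sub_neg_eq_add, ← two_smul ℝ, norm_smul, hQ.eigenvectorBasis.orthonormal.1 i]
    norm_num
  rw [e, smul_neg, add_neg_cancel] at h
  simp only [quad_eq_quadFun, quadFun, map_neg, map_zero, inner_neg_left, neg_neg, inner_neg_right,
    inner_zero_right, toEuclideanLin_eigenvectorBasis, real_inner_smul_right,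
    real_inner_self_eq_norm_sq, hQ.eigenvectorBasis.orthonormal.1 i, smul_eq_mul] at h
  linarith

/-- The proximal point `y` of the quadratic at `u` satisfies `u = y + γ ∇f(y)`. -/
lemma IsProx.quad_eq (hQ : Q.toEuclideanLin.IsSymmetric) (hγ : 0 < γ) {u y : E n}
    (h : IsProx γ (quadE Q q) u y) : u = y + γ • (Q.toEuclideanLin y + q) := by
  set c := (Q.toEuclideanLin y + q) + γ⁻¹ • (y - u) with hc
  have key : 0 ≤ -‖c‖ ^ 2 := by
    refine nonneg_of_forall_mul_add_sq
      (b := 1 / 2 * ⟪c, Q.toEuclideanLin c⟫ + 1 / (2 * γ) * ‖c‖ ^ 2) fun t _ _ => ?_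
    have hmin := isMinOn_iff.1 h (y + -(t • c)) (Set.mem_univ _)
    simp only [quadE] at hmin
    norm_cast at hmin
    rw [quad_eq_quadFun, quad_eq_quadFun, quadFun_add hQ,
      show y + -(t • c) - u = (y - u) - t • c by abel,
      norm_sub_sq_real (y - u) (t • c)] at hmin
    have e : ⟪Q.toEuclideanLin y + q, c⟫ = ‖c‖ ^ 2 - γ⁻¹ * ⟪y - u, c⟫ := by
      rw [← real_inner_self_eq_norm_sq, ← real_inner_smul_left, ← inner_sub_left]
      congr 1
      rw [hc]; abel
    simp only [map_neg, map_smul, inner_neg_left, neg_neg, inner_neg_right, real_inner_smul_left,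
      real_inner_smul_right, norm_smul, mul_pow, Real.norm_eq_abs, sq_abs, e] at hmin
    have e2 : 1 / (2 * γ) * (2 * (t * ⟪y - u, c⟫)) = t * (γ⁻¹ * ⟪y - u, c⟫) := by field_simp
    rw [mul_add (1 / (2 * γ)), mul_sub (1 / (2 * γ)), e2] at hmin
    linarith
  have hc0 : c = 0 := by
    rw [← norm_eq_zero, ← sq_eq_zero_iff]
    exact le_antisymm (by linarith) (sq_nonneg _)
  have h1 : γ • c = 0 := by rw [hc0, smul_zero]
  rw [hc, smul_add, smul_inv_smul₀ hγ.ne'] at h1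
  rw [← sub_eq_zero, ← neg_eq_zero, ← h1]
  abel

/-- A fixed point of the splitting gives a minimizer of the objective. -/
lemma coe_le_optValue (hQ : Q.toEuclideanLin.IsSymmetric)
    (hQ0 : ∀ d : E n, 0 ≤ ⟪d, Q.toEuclideanLin d⟫) {g : E n → EReal}
    (hg : IsProperClosedConvex g) (hγ : 0 < γ) {xt p : E n} (hpf : IsProx γ (quadE Q q) xt p)
    (hpg : IsProx γ g ((2 : ℝ) • p - xt) p) :
    ((quadFun Q.toEuclideanLin q p + (g p).toReal : ℝ) : EReal) ≤ optValue (quadE Q q) g := by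
  refine le_iInf fun w => ?_
  by_cases hw : g w = ⊤
  · rw [objective, hw, quadE, EReal.coe_add_top]
    exact le_top
  have h := hpg.subgradient hg hw
  have e : γ⁻¹ • ((2 : ℝ) • p - xt - p) = -(Q.toEuclideanLin p + q) := by
    rw [hpf.quad_eq hQ hγ, show (2 : ℝ) • p - (p + γ • (Q.toEuclideanLin p + q)) - p
      = γ • -(Q.toEuclideanLin p + q) by module, inv_smul_smul₀ hγ.ne']
  have hf := quadFun_add hQ q p (w - p)
  rw [add_sub_cancel] at hf
  rw [e, inner_neg_left] at h
  rw [objective, quadE, quad_eq_quadFun, ← hg.coe_toReal hw]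
  norm_cast
  linarith [hQ0 (w - p)]

/-- The first term of the minimum in `muEnvelope` gives `μ_h ≤ γ μ_f / (1 + γ μ_f)`, a
strong convexity modulus of the envelope in the metric of `D⁻¹`, by `mul_drForm_le`. -/
lemma muH_bounds (hne : (spectrum ℝ Q).Nonempty) (hQ : Q.IsHermitian) (hγ : 0 < γ)
    (hpos : 0 < lambdaMin Q) (hlt : γ * lambdaMax Q < 1) :
    0 < muH Q γ ∧ muH Q γ * (1 + γ * lambdaMin Q) ≤ γ * lambdaMin Q := by
  have hle : lambdaMin Q ≤ lambdaMax Q :=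
    (isGreatest_lambdaMax hne).2 (isLeast_lambdaMin hne).1
  have ha0 := mul_pos hγ hpos
  have hb0 := mul_pos hγ (hpos.trans_le hle)
  have hab := mul_le_mul_of_nonneg_left hle hγ.le
  have ha1 : 0 < 1 - γ * lambdaMin Q := by linarith
  have hb1 : 0 < 1 - γ * lambdaMax Q := by linarith
  have hK : 0 < γ * ((1 + γ * lambdaMin Q) / (1 - γ * lambdaMin Q)) := by positivity
  rw [muH, lambdaMin_scalingMatrix hQ hne hγ hpos hlt, muEnvelope]
  have hpos' := hpos.trans_le hle
  refine ⟨mul_pos hK (lt_min (by positivity) (by positivity)), ?_⟩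
  calc _ ≤ γ * ((1 + γ * lambdaMin Q) / (1 - γ * lambdaMin Q)) *
        ((1 - γ * lambdaMin Q) * lambdaMin Q / (1 + γ * lambdaMin Q) ^ 2) *
        (1 + γ * lambdaMin Q) := by
          gcongr
          exact min_le_left _ _
    _ = γ * lambdaMin Q := by field_simp

end Euclidean

end FastDRS

open FastDRS

theorem theorem6 {n : ℕ} (Q : Matrix (Fin n) (Fin n) ℝ) (q : FastDRS.E n)
    (hQ : Q.IsSymm)
    (hf : ∃ m : ℝ, 0 < m ∧ StrongConvexOn Set.univ m (FastDRS.quad Q q))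
    (g : FastDRS.E n → EReal) (hg : FastDRS.IsProperClosedConvex g)
    (γ : ℝ) (hγ : 0 < γ) (hγL : γ < 1 / FastDRS.lambdaMax Q)
    (x u y z : ℕ → FastDRS.E n)
    (hiter : FastDRS.IsFastDRS γ (FastDRS.quadE Q q) g
      (fun _ => (1 - γ * FastDRS.lambdaMax Q) / (1 + γ * FastDRS.lambdaMax Q))
      (fun _ => (1 - Real.sqrt (FastDRS.muH Q γ / FastDRS.LH Q γ)) /
        (1 + Real.sqrt (FastDRS.muH Q γ / FastDRS.LH Q γ)))
      x u y z)
    (xtilde : FastDRS.E n) (hx : xtilde ∈ FastDRS.fixedPoints γ (FastDRS.quadE Q q) g)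
    (k : ℕ) :
    FastDRS.objective (FastDRS.quadE Q q) g (z k) - FastDRS.optValue (FastDRS.quadE Q q) g ≤
      ((FastDRS.LH Q γ / FastDRS.lambdaMin (FastDRS.scalingMatrix Q γ) *
        (1 - Real.sqrt (FastDRS.muH Q γ / FastDRS.LH Q γ)) ^ k * ‖x 0 - xtilde‖ ^ 2 : ℝ) :
        EReal) := by
  obtain ⟨m₀, hm₀, hconv⟩ := hf
  obtain ⟨p, hpf, hpg⟩ := hx
  have hH : Q.IsHermitian := by
    rw [Matrix.IsHermitian, Matrix.conjTranspose_eq_transpose_of_trivial]; exact hQ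
  have hLpos : 0 < lambdaMax Q := one_div_pos.1 (hγ.trans hγL)
  have hne : (spectrum ℝ Q).Nonempty := by
    -- the supremum of the empty set is `0`
    by_contra h
    rw [lambdaMax, Set.not_nonempty_iff_eq_empty.1 h, Real.sSup_empty] at hLpos
    exact hLpos.false
  have hlt : γ * lambdaMax Q < 1 := (lt_div_iff₀ hLpos).1 hγL
  have hmin := isLeast_lambdaMin hne
  have hmax := isGreatest_lambdaMax hne
  have hpos : 0 < lambdaMin Q := by
    obtain ⟨i, hi⟩ := hH.spectrum_real_eq_range_eigenvalues ▸ hmin.1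
    rw [← hi]
    exact eigenvalues_pos_of_strongConvexOn hH hm₀ hconv i
  have hK := lambdaMin_scalingMatrix hH hne hγ hpos hlt
  obtain ⟨hm, hma⟩ := muH_bounds hne hH hγ hpos hlt
  have ha0 : 0 < γ * lambdaMin Q := mul_pos hγ hpos
  have hab : γ * lambdaMin Q ≤ γ * lambdaMax Q := mul_le_mul_of_nonneg_left (hmin.2 hmax.1) hγ.le
  have hm1 : muH Q γ ≤ 1 := by nlinarith
  have hb1 : 0 < 1 - γ * lambdaMax Q := by linarith
  have hb2 : 0 < 1 + γ * lambdaMax Q := by linarith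
  have hLH : 1 ≤ LH Q γ := by rw [LH, one_le_div hb1]; linarith
  set s := (1 - γ * lambdaMax Q) / (1 + γ * lambdaMax Q) with hs
  have hs0 : 0 < s := div_pos hb1 hb2
  have hs1 : s ≤ 1 := by rw [hs, div_le_one hb2]; linarith
  have hθ : √(muH Q γ / LH Q γ) ^ 2 = muH Q γ * s := by
    rw [Real.sq_sqrt (by positivity), hs, LH]
    field_simp
  have hθ0 : 0 < √(muH Q γ / LH Q γ) := by positivity
  have hθ1 : √(muH Q γ / LH Q γ) ≤ 1 := by
    refine Real.sqrt_le_one.2 ?_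
    rw [div_le_one (by linarith)]
    exact hm1.trans hLH
  set θ := √(muH Q γ / LH Q γ)
  set T := Q.toEuclideanLin
  have hT := toEuclideanLin_eigenvectorBasis hH
  have hsymm : T.IsSymmetric := isSymmetric_of_eigenbasis hT
  have hspec := hH.eigenvalues_mem_spectrum_real
  have hpa : ∀ i, γ * lambdaMin Q ≤ γ * hH.eigenvalues i := fun i =>
    mul_le_mul_of_nonneg_left (hmin.2 (hspec i)) hγ.le
  have hp : ∀ i, 0 < γ * hH.eigenvalues i := fun i => ha0.trans_le (hpa i)
  have hp1 : ∀ i, γ * hH.eigenvalues i < 1 := fun i =>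
    (mul_le_mul_of_nonneg_left (hmax.2 (hspec i)) hγ.le).trans_lt hlt
  have hmp : ∀ i, muH Q γ * (1 + γ * hH.eigenvalues i) ≤ γ * hH.eigenvalues i := fun i => by
    nlinarith [hpa i]
  -- `A = (I + γT)⁻¹` carries the iterates from the `u`-variable to the `y`-variable
  obtain ⟨A, hA1, hA2⟩ := exists_resolvent hT hp
  have hB0 := drForm_self_nonneg hT hγ hp hp1
  have hpx : xtilde = p + γ • (T p + q) := hpf.quad_eq hsymm hγ
  have hu : ∀ j, u j = y j + γ • (T (y j) + q) := fun j => (hiter.prox_f j).quad_eq hsymm hγ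
  have hyA : ∀ j, y j = A (u j - γ • q) := fun j => by
    rw [hu, smul_add, ← add_assoc, add_sub_cancel_right, hA2]
  have hsub : ∀ j w, g w ≠ ⊤ →
      (g (z j)).toReal + ⟪γ⁻¹ • (y j - z j) - (T (y j) + q), w - z j⟫ ≤ (g w).toReal := by
    intro j w hw
    have h := (hiter.prox_g j).subgradient hg hw
    rwa [hu, show (2 : ℝ) • y j - (y j + γ • (T (y j) + q)) - z j
      = (y j - z j) - γ • (T (y j) + q) by module, smul_sub, inv_smul_smul₀ hγ.ne'] at h
  have hz := fun j => (hiter.prox_g j).ne_top hg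
  have hbound := potential_bound (a := fun j => A (x j - γ • q)) (ρ := fun j => A (y j - z j))
    (c := fun j => (g (z j)).toReal) (cp := (g p).toReal) hsymm hγ hB0
    (mul_drForm_le hT hγ hp1 hmp) (inner_le_drForm hT hγ hp hp1)
    hm hs0 hs1 hθ hθ0 hθ1 (fun j => hA1 _) (fun j i => hsub j _ (hz i))
    (fun j => hsub j _ (hpg.ne_top hg)) (by rw [hyA, hiter.init])
    (fun j => by
      simp only [hiter.step_x, hyA j, ← map_smul, ← map_sub]
      congr 1; module)
    (fun j => by
      simp only [hyA (j + 1), hiter.step_u, ← map_smul, ← map_sub, ← map_add]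
      congr 1
      have h1 : 1 + θ ≠ 0 := by positivity
      match_scalars <;> field_simp
      ring) k
  have hdesc := objective_eq_drModel hsymm hγ.ne' q (y k) (z k) (g (z k)).toReal
  have hr := drForm_le_inner hT hγ hp hp1 (A (y k - z k))
  rw [hA1] at hr
  have hfin : quadFun T q (z k) + (g (z k)).toReal - (quadFun T q p + (g p).toReal) ≤
      LH Q γ / lambdaMin (scalingMatrix Q γ) * (1 - θ) ^ k * ‖x 0 - xtilde‖ ^ 2 := by
    have h1 : quadFun T q (z k) + (g (z k)).toReal - (quadFun T q p + (g p).toReal) ≤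
        (1 - θ) ^ (k + 1) * ((1 + muH Q γ) / 2 * drForm γ T (y 0 - p) (y 0 - p)) := by
      have := mul_nonneg (sub_nonneg.2 hs1) (hB0 (A (y k - z k)))
      linarith
    have h2 := drForm_le_norm_sq hT hγ ha0 hpa (y 0 - p)
    have e : y 0 - p + γ • T (y 0 - p) = x 0 - xtilde := by
      rw [← hiter.init, hu, hpx, map_sub]; module
    rw [e, ← hK] at h2
    have hθ' : 0 ≤ 1 - θ := sub_nonneg.2 hθ1
    have h3 : (1 + muH Q γ) / 2 * drForm γ T (y 0 - p) (y 0 - p) ≤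
        LH Q γ * ((lambdaMin (scalingMatrix Q γ))⁻¹ * ‖x 0 - xtilde‖ ^ 2) :=
      mul_le_mul (by linarith) h2 (hB0 _) (by linarith)
    calc _ ≤ _ := h1
      _ ≤ (1 - θ) ^ k * (LH Q γ * ((lambdaMin (scalingMatrix Q γ))⁻¹ * ‖x 0 - xtilde‖ ^ 2)) :=
        mul_le_mul (pow_le_pow_of_le_one hθ' (by linarith) k.le_succ) h3
          (mul_nonneg (by linarith) (hB0 _)) (pow_nonneg hθ' k)
      _ = _ := by ring
  have hQ0 : ∀ d : E n, 0 ≤ ⟪d, T d⟫ := fun d => by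
    rw [inner_eq_sum_eigenbasis hH.eigenvectorBasis]
    refine Finset.sum_nonneg fun i _ => ?_
    rw [inner_eigenbasis_map hT]
    nlinarith [hmin.2 (hspec i), mul_self_nonneg ⟪hH.eigenvectorBasis i, d⟫]
  have hopt := coe_le_optValue hsymm hQ0 hg hγ hpf hpg
  rw [objective, quadE, quad_eq_quadFun, ← hg.coe_toReal (hz k), ← EReal.coe_add]
  refine (EReal.sub_le_sub le_rfl hopt).trans ?_
  rw [← EReal.coe_sub]
  exact_mod_cast hfin
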